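/- Let $\Omega\subset\mathbb R^d$, $d\ge 1$, be a bounded domain, and put $V:=H^1_0(\Omega)\times H^1_0(\Omega)$, $H:=L^2(\Omega)\times L^2(\Omega)$, with $(u,v)_V:=\sum_{i=1}^2\int_\Omega\nabla u_i\cdot\nabla v_i\,dx$ and $(h,g)_H:=\sum_{i=1}^2\int_\Omega h_ig_i\,dx$. Let $c_{VH}$ be the smallest constant with $\|v\|_H\le c_{VH}\|v\|_V$ for all $v\in V$ (so that $1/c_{VH}^2$ is the first Dirichlet eigenvalue of $-\Delta$ on $\Omega$). Let $f$ map $\Omega\times\mathbb R^2$ to the nonempty compact convex subsets of $\mathbb R^2$ such that A1) $x\mapsto f(x,s)$ is measurable for every $s\in\mathbb R^2$, and $s\mapsto f(x,s)$ is continuous (in the Hausdorff metric) for a.e. $x\in\Omega$; A2) for a.e. $x\in\Omega$ and all $s,t\in\mathbb R^2$, $\eta\in f(x,s)$ there is $\rho\in f(x,t)$ with $\langle\rho-\eta,t-s\rangle\le l_f\|t-s\|_2^2$; A3) there are $\alpha\in L^2(\Omega)$ and $\beta\ge0$ with $\|y\|_2\le\alpha(x)+\beta\|s\|_2$ for a.e.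 $x\in\Omega$, all $s\in\mathbb R^2$ and all $y\in f(x,s)$; where $l_f\in\mathbb R$ satisfies $l_f<1/c_{VH}^2$. Put $(u,v)_W:=(u,v)_V-l_f(u,v)_H$ and $\|u\|_W:=(u,u)_W^{1/2}$ on $V$, and let $J_W:V^*\to V$ be the Riesz isomorphism, $(J_W\phi,v)_W=\langle\phi,v\rangle$ for all $v\in V$. Let $F_V:V\to V^*$, $\langle F_V(u),v\rangle:=-(u,v)_V$ (that is, $F_V=(\Delta,\Delta)$), let $N_f(u):=\{h\in H: h(x)\in f(x,u(x))\text{ for a.e. }x\in\Omega\}$, with $H\subset V^*$ through $\langle g,v\rangle:=(g,v)_H$, and for $M\subset V$ let $\mathrm{Proj}_W(0,M)$ be the set of elements of $M$ of minimal $\|\cdot\|_W$-norm. Let $\sigma(v,A):=\sup_{y\in A}\langle y,v\rangle$ be the support function on $\mathbb R^2$. Let $l<0$. Then for every $v\in V$ the set $\mathrm{Proj}_W(0,J_WF_V(v)+J_WN_f(v))$ consists of exactly one point, and for every sequence $(u_n)_{n\in\mathbb N}\subset V$ given by the iteration $$u_{n+1}=u_n-\tfrac1{2l}\,\mathrm{Proj}_W\bigl(0,J_WF_V(u_n)+J_WN_f(u_n)\bigr)$$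 and every $n$, the function $-2l(u_{n+1}-u_n)\in V$ is the unique minimizer over $V$ of the functional $$I(h)=\tfrac12\|h\|_W^2-\langle F_V(u_n),h\rangle+\int_\Omega\sigma\bigl(-h(x),f(x,u_n(x))\bigr)\,dx$$ $$=\int_\Omega\Bigl[\tfrac12\sum_{i=1}^2\bigl(|\nabla h_i|^2-l_f|h_i|^2+2\nabla h_i\cdot\nabla u_{n,i}\bigr)+\sigma\bigl(-h(x),f(x,u_n(x))\bigr)\Bigr]dx,$$ where the integrands are integrable for every $h\in V$. -/

import Mathlib

open MeasureTheory Filter Topology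
open scoped ContDiff ENNReal RealInnerProductSpace

noncomputable section

namespace EllipticInclusion

/-- The plane `ℝ²` with the Euclidean scalar product. -/
abbrev R2 : Type := EuclideanSpace ℝ (Fin 2)

/-- The support function `σ(v, A) = sup_{y ∈ A} ⟨y, v⟩` of a (nonempty compact) set `A ⊆ ℝ²`. -/
def supp (v : R2) (A : Set R2) : ℝ := sSup ((fun y : R2 => ⟪y, v⟫) '' A)

variable {d : ℕ}

/-- Lebesgue measure on `Ω ⊆ ℝ^d`. -/
abbrev leb (Ω : Set (EuclideanSpace ℝ (Fin d))) : Measure (EuclideanSpace ℝ (Fin d)) :=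
  volume.restrict Ω

/-! ### The Sobolev space `H¹₀(Ω)` and the spaces `V ⊂ H` -/

/-- `L²(Ω) × L²(Ω; ℝ^d)`, in which a Sobolev function is represented as the pair `(u, ∇u)`. -/
abbrev L2Pair (Ω : Set (EuclideanSpace ℝ (Fin d))) : Type :=
  WithLp 2 (Lp ℝ 2 (leb Ω) × Lp (EuclideanSpace ℝ (Fin d)) 2 (leb Ω))

/-- `φ ∈ C_c^∞(Ω)`. -/
structure IsTestFunction (Ω : Set (EuclideanSpace ℝ (Fin d)))
    (φ : EuclideanSpace ℝ (Fin d) → ℝ) : Prop where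
  smooth : ContDiff ℝ ∞ φ
  compact : HasCompactSupport φ
  subset : tsupport φ ⊆ Ω

/-- The subspace of all pairs `(φ, ∇φ)` with `φ ∈ C_c^∞(Ω)`. -/
def testPairs (Ω : Set (EuclideanSpace ℝ (Fin d))) : Submodule ℝ (L2Pair Ω) where
  carrier := {p | ∃ φ, IsTestFunction Ω φ ∧ p.fst =ᵐ[leb Ω] φ ∧ p.snd =ᵐ[leb Ω] gradient φ}
  zero_mem' := by
    refine ⟨0, ⟨contDiff_const, HasCompactSupport.zero, by simp⟩, ?_, ?_⟩
    · exact Lp.coeFn_zero _ _ _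
    · have h0 : gradient (0 : EuclideanSpace ℝ (Fin d) → ℝ) = 0 := by
        funext x
        exact gradient_const x (0 : ℝ)
      rw [h0]
      exact Lp.coeFn_zero _ _ _
  add_mem' := by
    rintro p q ⟨φ, hφ, hp1, hp2⟩ ⟨ψ, hψ, hq1, hq2⟩
    refine ⟨φ + ψ, ⟨hφ.smooth.add hψ.smooth, hφ.compact.add hψ.compact,
      (tsupport_add φ ψ).trans (Set.union_subset hφ.subset hψ.subset)⟩, ?_, ?_⟩
    · exact (Lp.coeFn_add _ _).trans (hp1.add hq1)
    · have h0 : gradient (φ + ψ) = gradient φ + gradient ψ := by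
        funext x
        simp only [gradient, Pi.add_apply]
        rw [fderiv_add (hφ.smooth.differentiable (by simp) x)
          (hψ.smooth.differentiable (by simp) x), map_add]
      rw [h0]
      exact (Lp.coeFn_add _ _).trans (hp2.add hq2)
  smul_mem' := by
    rintro c p ⟨φ, hφ, hp1, hp2⟩
    refine ⟨c • φ, ⟨hφ.smooth.const_smul c, hφ.compact.smul_left (f := fun _ => c),
      (closure_mono (Function.support_const_smul_subset c φ)).trans hφ.subset⟩, ?_, ?_⟩
    · exact (Lp.coeFn_smul _ _).trans (hp1.const_smul c)
    · have h0 : gradient (c • φ) = c • gradient φ := by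
        funext x
        simp only [gradient, Pi.smul_apply]
        rw [fderiv_const_smul (hφ.smooth.differentiable (by simp) x), map_smulₛₗ]
        rfl
      rw [h0]
      exact (Lp.coeFn_smul _ _).trans (hp2.const_smul c)

/-- `H¹₀(Ω)`: the closure of `C_c^∞(Ω)` with respect to the `H¹` norm. -/
abbrev H01 (Ω : Set (EuclideanSpace ℝ (Fin d))) : Type := (testPairs Ω).topologicalClosure

/-- The function in `L²(Ω)` underlying an element of `H¹₀(Ω)`. -/
def val (Ω : Set (EuclideanSpace ℝ (Fin d))) : H01 Ω →L[ℝ] Lp ℝ 2 (leb Ω) :=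
  (WithLp.fstL 2 ℝ _ _).comp (testPairs Ω).topologicalClosure.subtypeL

/-- The weak gradient of an element of `H¹₀(Ω)`. -/
def grad (Ω : Set (EuclideanSpace ℝ (Fin d))) :
    H01 Ω →L[ℝ] Lp (EuclideanSpace ℝ (Fin d)) 2 (leb Ω) :=
  (WithLp.sndL 2 ℝ _ _).comp (testPairs Ω).topologicalClosure.subtypeL

/-- `V = H¹₀(Ω) × H¹₀(Ω)`.  The norm of this type is the full `H¹` norm, it only serves to define
the topology of `V` and the dual space `V*`; the scalar product `(·,·)_V` is `innerV`. -/
abbrev V (Ω : Set (EuclideanSpace ℝ (Fin d))) : Type := PiLp 2 (fun _ : Fin 2 => H01 Ω)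

/-- `H = L²(Ω) × L²(Ω)`, with its Hilbert space structure. -/
abbrev H (Ω : Set (EuclideanSpace ℝ (Fin d))) : Type := PiLp 2 (fun _ : Fin 2 => Lp ℝ 2 (leb Ω))

variable {Ω : Set (EuclideanSpace ℝ (Fin d))}

/-- The value `h(x) = (h₁(x), h₂(x)) ∈ ℝ²` of `h ∈ H`. -/
def H.at (h : H Ω) (x : EuclideanSpace ℝ (Fin d)) : R2 := !₂[h 0 x, h 1 x]

/-- The embedding `V ⊂ H`. -/
def toH (u : V Ω) : H Ω := !₂[val Ω (u 0), val Ω (u 1)]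

/-- The scalar product `(u, v)_V = ∑ᵢ ∫_Ω ∇uᵢ · ∇vᵢ dx`. -/
def innerV (u v : V Ω) : ℝ := ∑ i, ⟪grad Ω (u i), grad Ω (v i)⟫

/-- The norm `‖u‖_V`. -/
def normV (u : V Ω) : ℝ := √(innerV u u)

/-- The embedding constant `c_{VH}`, i.e. the smallest `c ≥ 0` with `‖v‖_H ≤ c ‖v‖_V` on `V`;
thus `1 / c_{VH}²` is the first Dirichlet eigenvalue of `-Δ` on `Ω`. -/
def embConst (Ω : Set (EuclideanSpace ℝ (Fin d))) : ℝ :=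
  sInf {c : ℝ | 0 ≤ c ∧ ∀ v : V Ω, ‖toH v‖ ≤ c * normV v}

/-! ### The scalar product `(·,·)_W`, the Riesz map `J_W` and projections -/

/-- The scalar product `(u, v)_W = (u, v)_V - l_f (u, v)_H`. -/
def innerW (lf : ℝ) (u v : V Ω) : ℝ := innerV u v - lf * ⟪toH u, toH v⟫

/-- The norm `‖u‖_W`. -/
def normW (lf : ℝ) (u : V Ω) : ℝ := √(innerW lf u u)

/-- The Riesz map `J_W : V* → V`: `J_W φ` is the element of `V` with
`(J_W φ, v)_W = ⟨φ, v⟩` for all `v ∈ V` (it exists and is unique when `l_f < 1 / c_{VH}²`). -/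
def JW (lf : ℝ) (φ : StrongDual ℝ (V Ω)) : V Ω :=
  Classical.epsilon fun w : V Ω => ∀ v : V Ω, innerW lf w v = φ v

/-- `dist_W(x, M) = inf_{x' ∈ M} ‖x - x'‖_W`. -/
def distW (lf : ℝ) (x : V Ω) (M : Set (V Ω)) : ℝ := sInf ((fun x' => normW lf (x - x')) '' M)

/-- `Proj_W(x, M) = {x' ∈ M : ‖x - x'‖_W = dist_W(x, M)}`. -/
def projW (lf : ℝ) (x : V Ω) (M : Set (V Ω)) : Set (V Ω) :=
  {x' ∈ M | normW lf (x - x') = distW lf x M}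

/-! ### The right-hand side, the operators and the iteration -/

/-- The standing assumptions on the multivalued map `f : Ω × ℝ² → CC(ℝ²)`. -/
structure Admissible (Ω : Set (EuclideanSpace ℝ (Fin d)))
    (f : EuclideanSpace ℝ (Fin d) → R2 → Set R2) (lf : ℝ) : Prop where
  /-- The values of `f` are nonempty, -/
  nonempty : ∀ x ∈ Ω, ∀ s, (f x s).Nonempty
  /-- convex -/
  convex : ∀ x ∈ Ω, ∀ s, Convex ℝ (f x s)
  /-- and compact. -/
  compact : ∀ x ∈ Ω, ∀ s, IsCompact (f x s)
  /-- `x ↦ f(x, s)` is (Lebesgue) measurable for every `s`. -/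
  measurable : ∀ s, ∀ O : Set R2, IsOpen O →
    NullMeasurableSet {x ∈ Ω | (f x s ∩ O).Nonempty} volume
  /-- `s ↦ f(x, s)` is continuous in the Hausdorff metric for a.e. `x`. -/
  continuous : ∀ᵐ x ∂leb Ω, ∀ s,
    Tendsto (fun t => Metric.hausdorffDist (f x t) (f x s)) (𝓝 s) (𝓝 0)
  /-- `f` is uniformly relaxed one-sided Lipschitz with constant `l_f`. -/
  rosl : ∀ᵐ x ∂leb Ω, ∀ s t, ∀ η ∈ f x s, ∃ ρ ∈ f x t, ⟪ρ - η, t - s⟫ ≤ lf * ‖t - s‖ ^ 2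
  /-- `f` is linearly bounded. -/
  bounded : ∃ α : EuclideanSpace ℝ (Fin d) → ℝ, ∃ β : ℝ, MemLp α 2 (leb Ω) ∧ 0 ≤ β ∧
    ∀ᵐ x ∂leb Ω, ∀ s, ∀ y ∈ f x s, ‖y‖ ≤ α x + β * ‖s‖

/-- The embedding `H ⊂ V*`, `⟨g, v⟩ = (g, v)_H`. -/
def toDual (g : H Ω) : StrongDual ℝ (V Ω) :=
  ∑ i, (innerSL ℝ (g i)).comp ((val Ω).comp (PiLp.proj 2 (fun _ : Fin 2 => H01 Ω) i))

/-- The operator `F_V = (Δ, Δ) : V → V*`, `⟨F_V(u), v⟩ = -∑ᵢ ∫_Ω ∇uᵢ · ∇vᵢ dx`. -/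
def FV (u : V Ω) : StrongDual ℝ (V Ω) :=
  -∑ i, (innerSL ℝ (grad Ω (u i))).comp
    ((grad Ω).comp (PiLp.proj 2 (fun _ : Fin 2 => H01 Ω) i))

/-- The Nemytskii operator `N_f(u) = {h ∈ H : h(x) ∈ f(x, u(x)) a.e.}`. -/
def Nf (f : EuclideanSpace ℝ (Fin d) → R2 → Set R2) (u : H Ω) : Set (H Ω) :=
  {h | ∀ᵐ x ∂leb Ω, h.at x ∈ f x (u.at x)}

/-- The set `J_W F_V(u) + J_W N_f(u) ⊆ V`. -/
def residualSet (f : EuclideanSpace ℝ (Fin d) → R2 → Set R2) (lf : ℝ) (u : V Ω) : Set (V Ω) :=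
  {w | ∃ g ∈ Nf f (toH u), w = JW lf (FV u) + JW lf (toDual g)}

/-- The iteration `u_{n+1} = u_n - (1 / (2 l)) Proj_W(0, J_W F_V(u_n) + J_W N_f(u_n))`. -/
def IsIteration (f : EuclideanSpace ℝ (Fin d) → R2 → Set R2) (lf l : ℝ) (u : ℕ → V Ω) : Prop :=
  ∀ n, ∃ p ∈ projW lf 0 (residualSet f lf (u n)), u (n + 1) = u n - (1 / (2 * l)) • p

/-! ### The functional -/

/-- The function `x ↦ σ(-h(x), f(x, u(x)))`. -/
def suppIntegrand (f : EuclideanSpace ℝ (Fin d) → R2 → Set R2) (u h : V Ω)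
    (x : EuclideanSpace ℝ (Fin d)) : ℝ :=
  supp (-(toH h).at x) (f x ((toH u).at x))

/-- `I(h) = ½ ‖h‖_W² - ⟨F_V(u), h⟩ + ∫_Ω σ(-h(x), f(x, u(x))) dx`. -/
def functional (f : EuclideanSpace ℝ (Fin d) → R2 → Set R2) (lf : ℝ) (u h : V Ω) : ℝ :=
  1 / 2 * normW lf h ^ 2 - FV u h + ∫ x in Ω, suppIntegrand f u h x

/-- The function `x ↦ ½ ∑ᵢ (|∇hᵢ|² - l_f |hᵢ|² + 2 ∇hᵢ · ∇uᵢ) + σ(-h(x), f(x, u(x)))`. -/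
def fullIntegrand (f : EuclideanSpace ℝ (Fin d) → R2 → Set R2) (lf : ℝ) (u h : V Ω)
    (x : EuclideanSpace ℝ (Fin d)) : ℝ :=
  1 / 2 * ∑ i, (‖grad Ω (h i) x‖ ^ 2 - lf * |val Ω (h i) x| ^ 2
    + 2 * ⟪grad Ω (h i) x, grad Ω (u i) x⟫) + suppIntegrand f u h x

end EllipticInclusion

end

/-! Let `p` be the projection and write it as the Riesz representative of `F_V(u) + g₀` with a
selection `g₀ ∈ N_f(u)`. Minimality of `p` in the convex residual set means `(p, m - p)_W ≥ 0` for
every `m` in it (`innerW_sub_nonneg`). Taking for `m` the representative of `F_V(u) + g` turns this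
into `(g, -p)_H ≤ (g₀, -p)_H`, so `g₀` maximizes the pairing with `-p` over all selections.

That maximum equals `∫ σ(-p, f(x, u))`, because supremum and integral may be interchanged
(`integral_supp_le`). For any other `h` the selection `g₀` still gives `∫ σ(-h, f(x, u)) ≥ -(g₀,
h)_H`. Inserting both into the functional leaves a completed square, `I(h) ≥ I(p) + ½ ‖h - p‖_W²`
(`functional_add_le`), and coercivity of `(·,·)_W` makes `p` the only minimizer.

Measurable selections are nearest points: `x ↦ nearest (f x (u x)) (z x)` is a.e. measurable, and
nearest points to `k • w(x)` with `k` large almost attain the support function in direction `w(x)`.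
This gives nonemptiness of `N_f(u)`, measurability of the support integrand and the interchange. -/

noncomputable section

namespace EllipticInclusion

/-! ### Nearest points in convex sets -/

section Nearest

variable {E : Type*} [NormedAddCommGroup E] [InnerProductSpace ℝ E]

/-- The point of a complete convex set `A` nearest to `z`. -/
def nearest (A : Set E) (z : E) : E :=
  Classical.epsilon fun y => y ∈ A ∧ ∀ w ∈ A, ⟪z - y, w - y⟫ ≤ 0

theorem nearest_spec {A : Set E} (hne : A.Nonempty) (hA : IsComplete A) (hc : Convex ℝ A) (z : E) :
    nearest A z ∈ A ∧ ∀ w ∈ A, ⟪z - nearest A z, w - nearest A z⟫ ≤ 0 := by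
  obtain ⟨y, hy, h⟩ := exists_norm_eq_iInf_of_complete_convex hne hA hc z
  exact Classical.epsilon_spec (p := fun y => y ∈ A ∧ ∀ w ∈ A, ⟪z - y, w - y⟫ ≤ 0)
    ⟨y, hy, (norm_eq_iInf_iff_real_inner_le_zero hc hy).1 h⟩

/-- The angle at the nearest point is not acute, so Pythagoras holds as an inequality. In
particular, almost nearest points of `A` are close to the nearest one. -/
theorem norm_sub_nearest_sq_add_le {A : Set E} (hne : A.Nonempty) (hA : IsComplete A)
    (hc : Convex ℝ A) (z : E) {y : E} (hy : y ∈ A) :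
    ‖y - nearest A z‖ ^ 2 + ‖z - nearest A z‖ ^ 2 ≤ ‖z - y‖ ^ 2 := by
  have h := (nearest_spec hne hA hc z).2 y hy
  have e : z - y = (z - nearest A z) - (y - nearest A z) := by abel
  rw [e, norm_sub_sq_real (z - nearest A z)]
  linarith

theorem norm_nearest_sub_nearest_le {A : Set E} (hne : A.Nonempty) (hA : IsComplete A)
    (hc : Convex ℝ A) (z z' : E) : ‖nearest A z - nearest A z'‖ ≤ ‖z - z'‖ := by
  obtain ⟨m, h⟩ := nearest_spec hne hA hc z
  obtain ⟨m', h'⟩ := nearest_spec hne hA hc z'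
  have h1 := h _ m'
  have h2 := h' _ m
  set p := nearest A z
  set q := nearest A z'
  have h3 : ‖p - q‖ ^ 2 ≤ ⟪z - z', p - q⟫ := by
    rw [← real_inner_self_eq_norm_sq]
    simp only [inner_sub_left, inner_sub_right] at h1 h2 ⊢
    linarith
  have h4 := real_inner_le_norm (z - z') (p - q)
  nlinarith [norm_nonneg (p - q), norm_nonneg (z - z')]

/-- Each nearest point is tested against a point of its own set within the Hausdorff distance of the
other nearest point. Adding the two variational inequalities bounds the squared difference by terms
that are small with that distance. -/
theorem norm_nearest_sub_nearest_sq_le {A B : Set E} (hAne : A.Nonempty) (hA : IsCompact A)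
    (hAc : Convex ℝ A) (hBne : B.Nonempty) (hB : IsCompact B) (hBc : Convex ℝ B) (z : E) :
    ‖nearest A z - nearest B z‖ ^ 2 ≤
      Metric.hausdorffDist A B * (2 * ‖z - nearest A z‖ + Metric.hausdorffDist A B) := by
  obtain ⟨mA, hpA⟩ := nearest_spec hAne hA.isComplete hAc z
  obtain ⟨mB, hpB⟩ := nearest_spec hBne hB.isComplete hBc z
  have fin := Metric.hausdorffEDist_ne_top_of_nonempty_of_bounded hAne hBne hA.isBounded
    hB.isBounded
  obtain ⟨b, hb, eb⟩ := hB.exists_infDist_eq_dist hBne (nearest A z)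
  obtain ⟨a, ha, ea⟩ := hA.exists_infDist_eq_dist hAne (nearest B z)
  have lb := Metric.infDist_le_hausdorffDist_of_mem mA fin
  have la := Metric.infDist_le_hausdorffDist_of_mem mB (Metric.hausdorffEDist_comm (s := A) ▸ fin)
  rw [Metric.hausdorffDist_comm, ea, dist_eq_norm] at la
  rw [eb, dist_eq_norm] at lb
  have h1 := hpA a ha
  have h2 := hpB b hb
  have h3 := norm_sub_nearest_sq_add_le hBne hB.isComplete hBc z hb
  set r := Metric.hausdorffDist A B
  set p := nearest A z
  set q := nearest B z
  have h4 := real_inner_le_norm (z - p) (q - a)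
  have h5 := real_inner_le_norm (z - q) (p - b)
  have h6 : ‖p - q‖ ^ 2 ≤ ⟪z - p, q - a⟫ + ⟪z - q, p - b⟫ := by
    rw [← real_inner_self_eq_norm_sq]
    simp only [inner_sub_left, inner_sub_right] at h1 h2 ⊢
    linarith [real_inner_comm p q]
  have h7 : ‖z - q‖ ≤ ‖z - p‖ + r := by
    have : ‖z - b‖ ≤ ‖z - p‖ + ‖p - b‖ := norm_sub_le_norm_sub_add_norm_sub z p b
    have : ‖z - q‖ ≤ ‖z - b‖ := by
      refine (sq_le_sq₀ (norm_nonneg _) (norm_nonneg _)).1 ?_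
      nlinarith [sq_nonneg ‖b - q‖]
    linarith
  have h8 : ‖z - p‖ * ‖q - a‖ ≤ ‖z - p‖ * r := by gcongr
  have h9 : ‖z - q‖ * ‖p - b‖ ≤ (‖z - p‖ + r) * r := by
    have : 0 ≤ ‖z - p‖ + r := (norm_nonneg _).trans h7
    gcongr
  nlinarith

theorem continuous_nearest {S : Type*} [TopologicalSpace S] {F : S → Set E}
    (hne : ∀ s, (F s).Nonempty) (hcp : ∀ s, IsCompact (F s)) (hcv : ∀ s, Convex ℝ (F s))
    (hF : ∀ s, Tendsto (fun t => Metric.hausdorffDist (F t) (F s)) (𝓝 s) (𝓝 0)) :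
    Continuous fun q : S × E => nearest (F q.1) q.2 := by
  rw [continuous_iff_continuousAt]
  rintro ⟨s, z⟩
  rw [ContinuousAt, tendsto_iff_norm_sub_tendsto_zero]
  set r : S × E → ℝ := fun q => Metric.hausdorffDist (F s) (F q.1)
  have hr : Tendsto r (𝓝 (s, z)) (𝓝 0) := by
    have := (hF s).comp (continuous_fst.tendsto (s, z))
    refine this.congr fun q => ?_
    simp [r, Metric.hausdorffDist_comm]
  have hb : Tendsto (fun q : S × E => ‖q.2 - z‖ + √(r q * (2 * ‖z - nearest (F s) z‖ + r q)))
      (𝓝 (s, z)) (𝓝 0) := by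
    have h1 : Tendsto (fun q : S × E => ‖q.2 - z‖) (𝓝 (s, z)) (𝓝 0) := by
      have : Continuous fun q : S × E => ‖q.2 - z‖ := by fun_prop
      simpa using this.tendsto (s, z)
    have h2 := (hr.mul (hr.const_add (2 * ‖z - nearest (F s) z‖))).sqrt
    simpa using h1.add h2
  refine squeeze_zero (fun _ => norm_nonneg _) (fun q => ?_) hb
  have h1 := norm_nearest_sub_nearest_le (hne q.1) (hcp q.1).isComplete (hcv q.1) q.2 z
  have h2 := norm_nearest_sub_nearest_sq_le (hne s) (hcp s) (hcv s) (hne q.1) (hcp q.1) (hcv q.1) z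
  have h3 := Real.le_sqrt_of_sq_le h2
  rw [norm_sub_rev] at h3
  refine (norm_sub_le_norm_sub_add_norm_sub _ (nearest (F q.1) z) _).trans (add_le_add h1 h3)

theorem measurable_nearest {X : Type*} [MeasurableSpace X] [MeasurableSpace E] [BorelSpace E]
    {F : X → Set E} (hne : ∀ x, (F x).Nonempty) (hcp : ∀ x, IsCompact (F x))
    (hcv : ∀ x, Convex ℝ (F x)) (hF : ∀ O, IsOpen O → MeasurableSet {x | (F x ∩ O).Nonempty})
    (z : E) : Measurable fun x => nearest (F x) z := by
  refine measurable_of_isClosed fun C hC => ?_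
  -- The nearest point lies in `C` iff every ball about `z` of rational radius that meets `F x` also
  -- meets it in points arbitrarily close to `C`. Only hitting sets of open sets occur, and their
  -- measurability is the hypothesis.
  have key : (fun x => nearest (F x) z) ⁻¹' C = ⋂ n : ℕ, ⋂ q : ℚ,
      ({x | (F x ∩ Metric.ball z q).Nonempty}ᶜ ∪
        {x | (F x ∩ (Metric.thickening (1 / (n + 1)) C ∩ Metric.ball z q)).Nonempty}) := by
    ext x
    have hx := fun y => norm_sub_nearest_sq_add_le (hne x) (hcp x).isComplete (hcv x) z (y := y)
    have hm := (nearest_spec (hne x) (hcp x).isComplete (hcv x) z).1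
    set p := nearest (F x) z with hp
    simp only [Set.mem_preimage, Set.mem_iInter, Set.mem_union, Set.mem_compl_iff, Set.mem_ofPred_eq,
      ← imp_iff_not_or, ← hp]
    constructor
    · rintro hpC n q ⟨y, hy, hyq⟩
      refine ⟨p, hm, Metric.self_subset_thickening (by positivity) C hpC, ?_⟩
      rw [Metric.mem_ball, dist_comm, dist_eq_norm] at hyq ⊢
      refine lt_of_le_of_lt ((sq_le_sq₀ (norm_nonneg _) (norm_nonneg _)).1 ?_) hyq
      nlinarith [hx y hy, sq_nonneg ‖y - p‖]
    · intro h
      rw [← hC.closure_eq, Metric.mem_closure_iff]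
      intro ε hε
      obtain ⟨n, hn⟩ := exists_nat_one_div_lt (half_pos hε)
      -- The radius exceeds the distance so little that, by the Pythagoras inequality, points of `F
      -- x` in the ball are within `ε / 2` of `p`.
      obtain ⟨q, hq1, hq2⟩ := exists_rat_btwn
        (show ‖z - p‖ < √(‖z - p‖ ^ 2 + (ε / 2) ^ 2) from
          Real.lt_sqrt_of_sq_lt (by nlinarith [sq_pos_of_pos (half_pos hε)]))
      obtain ⟨y, hy, hyC, hyq⟩ := h n q ⟨p, hm, by
        rwa [Metric.mem_ball, dist_comm, dist_eq_norm]⟩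
      obtain ⟨c, hc, hyc⟩ := Metric.mem_thickening_iff.1 hyC
      refine ⟨c, hc, ?_⟩
      rw [Metric.mem_ball, dist_comm, dist_eq_norm] at hyq
      have h1 : ‖z - y‖ ^ 2 < ‖z - p‖ ^ 2 + (ε / 2) ^ 2 :=
        (Real.lt_sqrt (norm_nonneg _)).1 (hyq.trans hq2)
      have h2 : ‖y - p‖ < ε / 2 := by
        refine (sq_lt_sq₀ (norm_nonneg _) (half_pos hε).le).1 ?_
        linarith [hx y hy]
      calc dist p c ≤ dist p y + dist y c := dist_triangle _ _ _
        _ < ε / 2 + ε / 2 := by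
          rw [dist_comm p y, dist_eq_norm]
          linarith
        _ = ε := by ring
  rw [key]
  refine MeasurableSet.iInter fun n => MeasurableSet.iInter fun q => ?_
  exact (hF _ Metric.isOpen_ball).compl.union
    (hF _ (Metric.isOpen_thickening.inter Metric.isOpen_ball))

/-- The nearest point is a Carathéodory function, continuous in `(s, z)` and measurable in `x`. It
is therefore jointly measurable, and measurable functions may be substituted for `s` and `z`. -/
theorem aemeasurable_nearest [SecondCountableTopology E] [MeasurableSpace E] [BorelSpace E]
    {X S : Type*} [MeasurableSpace X] {μ : Measure X} [TopologicalSpace S]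
    [TopologicalSpace.MetrizableSpace S] [SecondCountableTopology S] [MeasurableSpace S]
    [BorelSpace S] {F : X → S → Set E} (hne : ∀ᵐ x ∂μ, ∀ s, (F x s).Nonempty)
    (hcp : ∀ᵐ x ∂μ, ∀ s, IsCompact (F x s)) (hcv : ∀ᵐ x ∂μ, ∀ s, Convex ℝ (F x s))
    (hmeas : ∀ s O, IsOpen O → NullMeasurableSet {x | (F x s ∩ O).Nonempty} μ)
    (hcont : ∀ᵐ x ∂μ, ∀ s, Tendsto (fun t => Metric.hausdorffDist (F x t) (F x s)) (𝓝 s) (𝓝 0))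
    {u : X → S} {z : X → E} (hu : AEMeasurable u μ) (hz : AEMeasurable z μ) :
    AEMeasurable (fun x => nearest (F x (u x)) (z x)) μ := by
  classical
  set P : X → Prop := fun x => (∀ s, (F x s).Nonempty) ∧ (∀ s, IsCompact (F x s)) ∧
    (∀ s, Convex ℝ (F x s)) ∧
    ∀ s, Tendsto (fun t => Metric.hausdorffDist (F x t) (F x s)) (𝓝 s) (𝓝 0)
  have hP : ∀ᵐ x ∂μ, P x := by
    filter_upwards [hne, hcp, hcv, hcont] with x h1 h2 h3 h4 using ⟨h1, h2, h3, h4⟩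
  -- Redefinition on the exceptional null set, together with the σ-algebra of null measurable sets,
  -- turns the a.e. hypotheses into everywhere ones.
  set G : X → S → Set E := fun x s => if P x then F x s else {0} with hG
  have hGF : ∀ᵐ x ∂μ, ∀ s, G x s = F x s := by
    filter_upwards [hP] with x hx s
    simp [hG, hx]
  have gne : ∀ x s, (G x s).Nonempty := fun x s => by
    by_cases h : P x
    · simpa [hG, h] using h.1 s
    · simp [hG, h]
  have gcp : ∀ x s, IsCompact (G x s) := fun x s => by
    by_cases h : P x
    · simpa [hG, h] using h.2.1 s
    · simp [hG, h]
  have gcv : ∀ x s, Convex ℝ (G x s) := fun x s => by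
    by_cases h : P x
    · simpa [hG, h] using h.2.2.1 s
    · simp [hG, h]
  have gcont : ∀ x s, Tendsto (fun t => Metric.hausdorffDist (G x t) (G x s)) (𝓝 s) (𝓝 0) :=
    fun x s => by
      by_cases h : P x
      · simpa [hG, h] using h.2.2.2 s
      · simp [hG, h]
  have gmeas : ∀ s O, IsOpen O →
      MeasurableSet {x : NullMeasurableSpace X μ | (G x s ∩ O).Nonempty} := fun s O hO => by
    refine NullMeasurableSet.congr (hmeas s O hO) ?_
    filter_upwards [hGF] with x hx
    exact propext (by
      change (F x s ∩ O).Nonempty ↔ (G x s ∩ O).Nonempty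
      rw [hx])
  have hunc : Measurable (Function.uncurry fun (i : S × E) (x : NullMeasurableSpace X μ) =>
      nearest (G x i.1) i.2) :=
    measurable_uncurry_of_continuous_of_measurable
      (fun x => continuous_nearest (gne x) (gcp x) (gcv x) (gcont x))
      (fun i => measurable_nearest (X := NullMeasurableSpace X μ) (F := fun x => G x i.1)
        (fun x => gne x i.1) (fun x => gcp x i.1) (fun x => gcv x i.1) (gmeas i.1) i.2)
  have hu' : Measurable fun x : NullMeasurableSpace X μ => u x := hu.nullMeasurable.measurable'
  have hz' : Measurable fun x : NullMeasurableSpace X μ => z x := hz.nullMeasurable.measurable'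
  have huz : Measurable fun x : NullMeasurableSpace X μ => (((u x, z x) : S × E), x) :=
    (hu'.prodMk hz').prodMk measurable_id
  have hfin : NullMeasurable (fun x => nearest (G x (u x)) (z x)) μ := hunc.comp huz
  refine hfin.aemeasurable.congr ?_
  filter_upwards [hGF] with x hx
  rw [hx]

end Nearest

/-! ### Minimization of convex functions and the Lax–Milgram solution operator -/

/-- A nonnegative continuous convex function attains its minimum on a nonempty bounded closed convex
subset of a Hilbert space. -/
theorem exists_forall_le_of_convexOn {E : Type*} [NormedAddCommGroup E] [InnerProductSpace ℝ E]
    [CompleteSpace E] {C : Set E} (hne : C.Nonempty) (hcl : IsClosed C)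
    (hb : Bornology.IsBounded C) {φ : E → ℝ} (hφ : Continuous φ) (hcv : ConvexOn ℝ C φ)
    (h0 : ∀ g, 0 ≤ φ g) : ∃ g ∈ C, ∀ y ∈ C, φ g ≤ φ y := by
  set m := sInf (φ '' C)
  have hbd : BddBelow (φ '' C) := ⟨0, by rintro _ ⟨g, -, rfl⟩; exact h0 g⟩
  set K : ℕ → Set E := fun n => {g ∈ C | φ g ≤ m + 1 / (n + 1)} with hK
  have Kne : ∀ n, (K n).Nonempty := fun n => by
    obtain ⟨_, ⟨g, hg, rfl⟩, h⟩ := exists_lt_of_csInf_lt (hne.image φ)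
      (lt_add_of_pos_right m (Nat.one_div_pos_of_nat (n := n) (α := ℝ)))
    exact ⟨g, hg, h.le⟩
  have Kcl : ∀ n, IsClosed (K n) := fun n => hcl.inter (isClosed_le hφ continuous_const)
  have Kcv : ∀ n, Convex ℝ (K n) := fun n => hcv.convex_le _
  have Kanti : ∀ {n k}, n ≤ k → K k ⊆ K n := fun {n k} hnk g hg =>
    ⟨hg.1, hg.2.trans (by gcongr)⟩
  -- The elements of least norm of the nested sublevel sets have increasing bounded norms, and `key`
  -- turns convergence of the norms into the Cauchy property. This takes the place of weak
  -- compactness.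
  set g : ℕ → E := fun n => nearest (K n) 0
  have gm : ∀ n, g n ∈ K n := fun n => (nearest_spec (Kne n) (Kcl n).isComplete (Kcv n) 0).1
  have key : ∀ {n k}, n ≤ k → ‖g k - g n‖ ^ 2 + ‖g n‖ ^ 2 ≤ ‖g k‖ ^ 2 := fun {n k} hnk => by
    have := norm_sub_nearest_sq_add_le (Kne n) (Kcl n).isComplete (Kcv n) 0 (Kanti hnk (gm k))
    simpa using this
  have hmono : Monotone fun n => ‖g n‖ ^ 2 := fun n k hnk => by
    have := key hnk
    have := sq_nonneg ‖g k - g n‖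
    simp only
    linarith
  obtain ⟨R, hR⟩ := hb.exists_norm_le
  have hbdd : BddAbove (Set.range fun n => ‖g n‖ ^ 2) := ⟨R ^ 2, by
    rintro _ ⟨n, rfl⟩
    have := hR _ (gm n).1
    simp only
    gcongr⟩
  have hlim := tendsto_atTop_ciSup hmono hbdd
  have hcau : CauchySeq g := by
    rw [Metric.cauchySeq_iff']
    intro ε hε
    obtain ⟨N, hN⟩ := ((tendsto_order.1 hlim).1 _
      (sub_lt_self (⨆ n, ‖g n‖ ^ 2) (sq_pos_of_pos hε))).exists
    refine ⟨N, fun n hn => ?_⟩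
    rw [dist_eq_norm]
    refine (sq_lt_sq₀ (norm_nonneg _) hε.le).1 ?_
    linarith [key hn, le_ciSup hbdd n]
  obtain ⟨a, ha⟩ := cauchySeq_tendsto_of_complete hcau
  have haK : ∀ n, a ∈ K n := fun n => (Kcl n).mem_of_tendsto ha
    (eventually_atTop.2 ⟨n, fun k hk => Kanti hk (gm k)⟩)
  refine ⟨a, (haK 0).1, fun y hy => ?_⟩
  have : φ a ≤ m := by
    refine ge_of_tendsto (x := atTop) (f := fun n : ℕ => m + 1 / ((n : ℝ) + 1)) ?_
      (Eventually.of_forall fun n => (haK n).2)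
    simpa using tendsto_one_div_add_atTop_nhds_zero_nat.const_add m
  exact this.trans (csInf_le hbd ⟨y, hy, rfl⟩)

/-- The solution operator `φ ↦ w` of `B w v = φ v` for all `v`. -/
def laxMilgramSolution {X : Type*} [NormedAddCommGroup X] [InnerProductSpace ℝ X] [CompleteSpace X]
    {B : X →L[ℝ] X →L[ℝ] ℝ} (hB : IsCoercive B) : StrongDual ℝ X →L[ℝ] X :=
  (hB.continuousLinearEquivOfBilin.symm : X →L[ℝ] X).comp
    ({ toFun := (InnerProductSpace.toDual ℝ X).symm
       map_add' := map_add _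
       map_smul' := fun c φ => by simp
       cont := (InnerProductSpace.toDual ℝ X).symm.continuous } : StrongDual ℝ X →L[ℝ] X)

theorem laxMilgramSolution_apply {X : Type*} [NormedAddCommGroup X] [InnerProductSpace ℝ X]
    [CompleteSpace X] {B : X →L[ℝ] X →L[ℝ] ℝ} (hB : IsCoercive B) (φ : StrongDual ℝ X) (v : X) :
    B (laxMilgramSolution hB φ) v = φ v := by
  rw [← hB.continuousLinearEquivOfBilin_apply, laxMilgramSolution]
  simp

/-! ### The scalar product `(·,·)_W` -/

variable {d : ℕ} {Ω : Set (EuclideanSpace ℝ (Fin d))}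

instance instNormedAddCommGroupV : NormedAddCommGroup (V Ω) := inferInstance

set_option synthInstance.maxHeartbeats 400000 in
instance instInnerProductSpaceV : InnerProductSpace ℝ (V Ω) := inferInstance

instance instNormedSpaceV : NormedSpace ℝ (V Ω) := InnerProductSpace.toNormedSpace

instance instCompleteSpaceV : CompleteSpace (V Ω) := inferInstance

instance instModuleV : Module ℝ (V Ω) := inferInstance

@[simp] theorem toH_apply (u : V Ω) (i : Fin 2) : toH u i = val Ω (u i) := by
  fin_cases i <;> rfl

theorem inner_H (g h : H Ω) : ⟪g, h⟫ = ∑ i, ⟪g i, h i⟫ := PiLp.inner_apply g h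

theorem norm_sq_V (u : V Ω) : ‖u‖ ^ 2 = ‖toH u‖ ^ 2 + innerV u u := by
  rw [← real_inner_self_eq_norm_sq (toH u), inner_H, innerV, ← Finset.sum_add_distrib,
    PiLp.norm_sq_eq_of_L2]
  refine Finset.sum_congr rfl fun i _ => ?_
  rw [toH_apply, real_inner_self_eq_norm_sq, real_inner_self_eq_norm_sq]
  exact WithLp.prod_norm_sq_eq_of_L2 (u i : L2Pair Ω)

theorem innerV_self_nonneg (u : V Ω) : 0 ≤ innerV u u :=
  Finset.sum_nonneg fun _ _ => real_inner_self_nonneg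

/-- The component `V → L²(Ω)` of the embedding `V ⊂ H`. -/
def valL (i : Fin 2) : V Ω →L[ℝ] Lp ℝ 2 (leb Ω) :=
  (val Ω).comp (PiLp.proj 2 (fun _ : Fin 2 => H01 Ω) i)

/-- The weak gradient of a component of an element of `V`. -/
def gradL (i : Fin 2) : V Ω →L[ℝ] Lp (EuclideanSpace ℝ (Fin d)) 2 (leb Ω) :=
  (grad Ω).comp (PiLp.proj 2 (fun _ : Fin 2 => H01 Ω) i)

/-- The scalar product `(·,·)_W` as a continuous bilinear map. -/
def innerWL (lf : ℝ) : V Ω →L[ℝ] V Ω →L[ℝ] ℝ :=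
  ∑ i, ((innerSL ℝ).bilinearComp (gradL i) (gradL i) -
    lf • (innerSL ℝ).bilinearComp (valL i) (valL i))

theorem innerWL_apply (lf : ℝ) (u v : V Ω) : innerWL lf u v = innerW lf u v := by
  simp [innerWL, innerW, innerV, inner_H, gradL, valL]
  ring

theorem innerW_comm (lf : ℝ) (u v : V Ω) : innerW lf u v = innerW lf v u := by
  rw [innerW, innerW, innerV, innerV, real_inner_comm]
  simp_rw [real_inner_comm (grad Ω (u _))]

/-- The admissible constants form a closed set, so the infimum is attained. A nonzero value excludes
the empty set, whose `sInf` is `0`. -/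
theorem norm_toH_le_embConst (h : embConst Ω ≠ 0) (u : V Ω) : ‖toH u‖ ≤ embConst Ω * normV u := by
  set S := {c : ℝ | 0 ≤ c ∧ ∀ v : V Ω, ‖toH v‖ ≤ c * normV v}
  have hne : S.Nonempty := by
    rw [Set.nonempty_iff_ne_empty]
    intro hS
    exact h (by rw [embConst]; change sInf S = 0; rw [hS, Real.sInf_empty])
  have hcl : IsClosed S := by
    refine isClosed_Ici.inter ?_
    change IsClosed {c : ℝ | ∀ v : V Ω, ‖toH v‖ ≤ c * normV v}
    rw [Set.ofPred_forall]
    exact isClosed_iInter fun v => isClosed_le continuous_const (by fun_prop)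
  exact (hcl.csInf_mem hne ⟨0, fun c hc => hc.1⟩).2 u

theorem exists_mul_norm_sq_le_innerW {lf : ℝ} (hlf : lf < 1 / embConst Ω ^ 2) :
    ∃ C, 0 < C ∧ ∀ u : V Ω, C * ‖u‖ ^ 2 ≤ innerW lf u u := by
  rcases lt_or_ge lf 0 with h | h
  · refine ⟨min 1 (-lf), lt_min one_pos (neg_pos.2 h), fun u => ?_⟩
    rw [norm_sq_V, innerW, real_inner_self_eq_norm_sq]
    have h1 := mul_le_mul_of_nonneg_right (min_le_left 1 (-lf)) (innerV_self_nonneg u)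
    have h2 := mul_le_mul_of_nonneg_right (min_le_right 1 (-lf)) (sq_nonneg ‖toH u‖)
    linarith
  -- If the constant were `0`, the convention `1 / 0 = 0` would make the hypothesis read `lf < 0`.
  · have hc : embConst Ω ≠ 0 := by
      intro hc
      rw [hc] at hlf
      norm_num at hlf
      linarith
    set c := embConst Ω
    have hc2 : 0 < c ^ 2 := by positivity
    rw [lt_div_iff₀ hc2] at hlf
    -- The ratio of `innerW lf u u` to `‖u‖ ^ 2` in the extremal case `‖toH u‖ ^ 2 = c ^ 2 * innerV
    -- u u`.
    refine ⟨(1 - lf * c ^ 2) / (1 + c ^ 2), div_pos (by linarith) (by positivity), fun u => ?_⟩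
    have h1 : ‖toH u‖ ^ 2 ≤ c ^ 2 * innerV u u := by
      have := norm_toH_le_embConst hc u
      calc ‖toH u‖ ^ 2 ≤ (c * normV u) ^ 2 := by gcongr
        _ = c ^ 2 * innerV u u := by rw [mul_pow, normV, Real.sq_sqrt (innerV_self_nonneg u)]
    rw [norm_sq_V, innerW, real_inner_self_eq_norm_sq, div_mul_eq_mul_div,
      div_le_iff₀ (by positivity)]
    set t := ‖toH u‖ ^ 2
    set N := innerV u u
    have h2 : 0 ≤ (1 + lf) * (c ^ 2 * N - t) := mul_nonneg (by linarith) (sub_nonneg.2 h1)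
    linarith

theorem innerW_self_nonneg {lf : ℝ} (hlf : lf < 1 / embConst Ω ^ 2) (u : V Ω) :
    0 ≤ innerW lf u u := by
  obtain ⟨C, hC, h⟩ := exists_mul_norm_sq_le_innerW hlf
  exact le_trans (by positivity) (h u)

theorem eq_zero_of_innerW_self_le {lf : ℝ} (hlf : lf < 1 / embConst Ω ^ 2) {u : V Ω}
    (hu : innerW lf u u ≤ 0) : u = 0 := by
  obtain ⟨C, hC, h⟩ := exists_mul_norm_sq_le_innerW hlf
  have h1 := (h u).trans hu
  have h2 : ‖u‖ ^ 2 ≤ 0 := by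
    by_contra h3
    push Not at h3
    nlinarith [mul_pos hC h3]
  exact norm_eq_zero.1 (pow_eq_zero_iff two_ne_zero |>.1 (le_antisymm h2 (sq_nonneg _)))

theorem normW_sq {lf : ℝ} (hlf : lf < 1 / embConst Ω ^ 2) (u : V Ω) :
    normW lf u ^ 2 = innerW lf u u := Real.sq_sqrt (innerW_self_nonneg hlf u)

theorem isCoercive_innerWL {lf : ℝ} (hlf : lf < 1 / embConst Ω ^ 2) :
    IsCoercive (innerWL lf : V Ω →L[ℝ] V Ω →L[ℝ] ℝ) := by
  obtain ⟨C, hC, h⟩ := exists_mul_norm_sq_le_innerW hlf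
  exact ⟨C, hC, fun u => by rw [innerWL_apply, mul_assoc, ← sq]; exact h u⟩

/-- The Riesz map of `(·,·)_W` as a continuous linear map. -/
def rieszW {lf : ℝ} (hlf : lf < 1 / embConst Ω ^ 2) : StrongDual ℝ (V Ω) →L[ℝ] V Ω :=
  laxMilgramSolution (isCoercive_innerWL hlf)

theorem innerW_rieszW {lf : ℝ} (hlf : lf < 1 / embConst Ω ^ 2) (φ : StrongDual ℝ (V Ω)) (v : V Ω) :
    innerW lf (rieszW hlf φ) v = φ v := by
  rw [← innerWL_apply, rieszW, laxMilgramSolution_apply]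

theorem innerW_JW {lf : ℝ} (hlf : lf < 1 / embConst Ω ^ 2) (φ : StrongDual ℝ (V Ω)) (v : V Ω) :
    innerW lf (JW lf φ) v = φ v :=
  Classical.epsilon_spec (p := fun w : V Ω => ∀ v : V Ω, innerW lf w v = φ v)
    ⟨rieszW hlf φ, innerW_rieszW hlf φ⟩ v

theorem innerW_sub_left (lf : ℝ) (u v w : V Ω) :
    innerW lf (u - v) w = innerW lf u w - innerW lf v w := by
  simp [← innerWL_apply]

theorem innerW_add_left (lf : ℝ) (u v w : V Ω) :
    innerW lf (u + v) w = innerW lf u w + innerW lf v w := by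
  simp [← innerWL_apply]

theorem innerW_sub_right (lf : ℝ) (u v w : V Ω) :
    innerW lf u (v - w) = innerW lf u v - innerW lf u w := by
  simp [← innerWL_apply]

theorem innerW_add_right (lf : ℝ) (u v w : V Ω) :
    innerW lf u (v + w) = innerW lf u v + innerW lf u w := by
  simp [← innerWL_apply]

theorem innerW_smul_right (lf : ℝ) (c : ℝ) (u v : V Ω) :
    innerW lf u (c • v) = c * innerW lf u v := by
  simp [← innerWL_apply]

/-- Coercivity makes the representative unique, so the map defined by choice inherits linearity and
continuity. -/
theorem JW_eq_rieszW {lf : ℝ} (hlf : lf < 1 / embConst Ω ^ 2) (φ : StrongDual ℝ (V Ω)) :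
    JW lf φ = rieszW hlf φ := by
  refine sub_eq_zero.1 (eq_zero_of_innerW_self_le hlf (le_of_eq ?_))
  rw [innerW_sub_left, innerW_JW hlf, innerW_rieszW, sub_self]

theorem toDual_apply (g : H Ω) (v : V Ω) : toDual g v = ⟪g, toH v⟫ := by
  simp [toDual, inner_H]

theorem FV_apply (u v : V Ω) : FV u v = -innerV u v := by
  simp [FV, innerV]

/-- The embedding `H ⊂ V*` as a continuous linear map. -/
def toDualL : H Ω →L[ℝ] StrongDual ℝ (V Ω) :=
  ∑ i, (innerSL ℝ).bilinearComp (PiLp.proj 2 (fun _ : Fin 2 => Lp ℝ 2 (leb Ω)) i) (valL i)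

theorem toDualL_apply (g : H Ω) : toDualL g = toDual g := by
  ext v
  simp [toDualL, toDual, valL]

/-- The convexity of `w ↦ ‖w₀ + T w‖_W²`. -/
theorem convexOn_innerW_self {lf : ℝ} (hlf : lf < 1 / embConst Ω ^ 2) (w₀ : V Ω)
    (T : H Ω →L[ℝ] V Ω) {C : Set (H Ω)} (hC : Convex ℝ C) :
    ConvexOn ℝ C fun g => innerW lf (w₀ + T g) (w₀ + T g) := by
  have hq : ConvexOn ℝ Set.univ fun w : V Ω => innerW lf w w := by
    refine ⟨convex_univ, fun x _ y _ a b ha hb hab => ?_⟩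
    -- The convexity defect of the quadratic form is exactly `a * b` times its value at `x - y`.
    have h := mul_nonneg (mul_nonneg ha hb) (innerW_self_nonneg hlf (x - y))
    obtain rfl : b = 1 - a := by linarith
    simp only [← innerWL_apply, map_add, map_smul, map_sub, add_apply,
      sub_apply, smul_apply, smul_eq_mul] at h ⊢
    linarith
  have := (hq.comp_affineMap ((AffineMap.const ℝ (H Ω) w₀) + T.toLinearMap.toAffineMap))
  exact this.subset (Set.subset_univ _) hC

/-! ### Elements of `H` as functions with values in the plane -/

@[simp] theorem at_apply (h : H Ω) (x : EuclideanSpace ℝ (Fin d)) (i : Fin 2) :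
    h.at x i = h i x := by
  fin_cases i <;> rfl

theorem memLp_at (h : H Ω) : MemLp h.at 2 (leb Ω) :=
  MemLp.of_eval_piLp fun i => by
    simp only [at_apply]
    exact Lp.memLp (h i)

/-- The element of `H` given by a square integrable function with values in the plane. -/
def ofFun (g : EuclideanSpace ℝ (Fin d) → R2) (hg : MemLp g 2 (leb Ω)) : H Ω :=
  WithLp.toLp 2 fun i => (hg.eval_piLp i).toLp _

theorem ofFun_at (g : EuclideanSpace ℝ (Fin d) → R2) (hg : MemLp g 2 (leb Ω)) :
    (ofFun g hg).at =ᵐ[leb Ω] g := by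
  have h : ∀ i, ⇑((hg.eval_piLp i).toLp _) =ᵐ[leb Ω] fun x => g x i :=
    fun i => (hg.eval_piLp i).coeFn_toLp
  filter_upwards [ae_all_iff.2 h] with x hx
  ext i
  rw [at_apply]
  exact hx i

theorem at_add (g h : H Ω) : (g + h).at =ᵐ[leb Ω] fun x => g.at x + h.at x := by
  filter_upwards [ae_all_iff.2 fun i => Lp.coeFn_add (g i) (h i)] with x hx
  ext i
  simpa using hx i

theorem at_smul (c : ℝ) (h : H Ω) : (c • h).at =ᵐ[leb Ω] fun x => c • h.at x := by
  filter_upwards [ae_all_iff.2 fun i => Lp.coeFn_smul c (h i)] with x hx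
  ext i
  simpa using hx i

theorem integrable_inner_of_memLp {E : Type*} [NormedAddCommGroup E] [InnerProductSpace ℝ E]
    {X : Type*} [MeasurableSpace X] {μ : Measure X} {g h : X → E} (hg : MemLp g 2 μ)
    (hh : MemLp h 2 μ) : Integrable (fun x => ⟪g x, h x⟫) μ := by
  refine (L2.integrable_inner (𝕜 := ℝ) (hg.toLp g) (hh.toLp h)).congr ?_
  filter_upwards [hg.coeFn_toLp, hh.coeFn_toLp] with x h1 h2
  rw [h1, h2]

theorem inner_H_eq_integral (g h : H Ω) : ⟪g, h⟫ = ∫ x in Ω, ⟪g.at x, h.at x⟫ := by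
  rw [inner_H]
  simp_rw [L2.inner_def]
  rw [← integral_finsetSum _ fun i _ => L2.integrable_inner (𝕜 := ℝ) (g i) (h i)]
  simp [PiLp.inner_apply]

/-! ### The support function -/

theorem bddAbove_inner {A : Set R2} {R : ℝ} (hR : ∀ y ∈ A, ‖y‖ ≤ R) (v : R2) :
    BddAbove ((fun y : R2 => ⟪y, v⟫) '' A) := ⟨R * ‖v‖, by
  rintro _ ⟨y, hy, rfl⟩
  exact (real_inner_le_norm y v).trans (by gcongr; exact hR y hy)⟩

theorem inner_le_supp {A : Set R2} {R : ℝ} (hR : ∀ y ∈ A, ‖y‖ ≤ R) (v : R2) {y : R2}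
    (hy : y ∈ A) : ⟪y, v⟫ ≤ supp v A :=
  le_csSup (bddAbove_inner hR v) ⟨y, hy, rfl⟩

theorem abs_supp_le {A : Set R2} {R : ℝ} (hA : A.Nonempty) (hR : ∀ y ∈ A, ‖y‖ ≤ R) (v : R2) :
    |supp v A| ≤ R * ‖v‖ := by
  obtain ⟨y, hy⟩ := hA
  have h1 : |⟪y, v⟫| ≤ R * ‖v‖ :=
    (abs_real_inner_le_norm y v).trans (by gcongr; exact hR y hy)
  refine abs_le.2 ⟨(neg_le_of_abs_le h1).trans (inner_le_supp hR v hy), ?_⟩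
  refine csSup_le ⟨_, y, hy, rfl⟩ ?_
  rintro _ ⟨z, hz, rfl⟩
  exact (real_inner_le_norm z v).trans (by gcongr; exact hR z hz)

/-- For `p` nearest to `k • v`, the variational inequality reads `k ⟪y - p, v⟫ ≤ ⟪p, y - p⟫`, and
the right side is at most `R ^ 2`. So `p` nearly maximizes `⟪·, v⟫` on `A`. -/
theorem supp_le_inner_nearest_add {A : Set R2} {R : ℝ} (hne : A.Nonempty) (hcp : IsCompact A)
    (hcv : Convex ℝ A) (hR : ∀ y ∈ A, ‖y‖ ≤ R) (v : R2) {k : ℝ} (hk : 0 < k) :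
    supp v A ≤ ⟪nearest A (k • v), v⟫ + 1 / k * R ^ 2 := by
  obtain ⟨hm, h⟩ := nearest_spec hne hcp.isComplete hcv (k • v)
  refine csSup_le (hne.image _) ?_
  rintro _ ⟨y, hy, rfl⟩
  have h1 := h y hy
  set p := nearest A (k • v)
  have hp := hR p hm
  have h2 : ⟪p, y⟫ ≤ R ^ 2 := by
    have := hR y hy
    calc ⟪p, y⟫ ≤ ‖p‖ * ‖y‖ := real_inner_le_norm p y
      _ ≤ R * R := mul_le_mul hp this (norm_nonneg _) ((norm_nonneg _).trans hp)
      _ = R ^ 2 := (sq R).symm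
  have h3 : k * (⟪y, v⟫ - ⟪p, v⟫) ≤ R ^ 2 := by
    simp only [inner_sub_left, inner_sub_right, real_inner_smul_left] at h1
    have := real_inner_self_nonneg (x := p)
    rw [real_inner_comm v y, real_inner_comm v p]
    linarith
  have h4 : ⟪y, v⟫ - ⟪p, v⟫ ≤ R ^ 2 / k := (le_div_iff₀' hk).2 h3
  simp only
  rw [one_div, inv_mul_eq_div]
  linarith

theorem tendsto_inner_nearest {A : Set R2} {R : ℝ} (hne : A.Nonempty) (hcp : IsCompact A)
    (hcv : Convex ℝ A) (hR : ∀ y ∈ A, ‖y‖ ≤ R) (v : R2) :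
    Tendsto (fun k : ℕ => ⟪nearest A (((k : ℝ) + 1) • v), v⟫) atTop (𝓝 (supp v A)) := by
  have hlim : Tendsto (fun k : ℕ => supp v A - 1 / ((k : ℝ) + 1) * R ^ 2) atTop
      (𝓝 (supp v A)) := by
    simpa using (tendsto_one_div_add_atTop_nhds_zero_nat.mul_const (R ^ 2)).const_sub (supp v A)
  refine tendsto_of_tendsto_of_tendsto_of_le_of_le hlim tendsto_const_nhds (fun k => ?_)
    fun k => inner_le_supp hR _ (nearest_spec hne hcp.isComplete hcv _).1
  have := supp_le_inner_nearest_add hne hcp hcv hR v (k := (k : ℝ) + 1) (by positivity)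
  simp only
  linarith

/-! ### The Nemytskii operator -/

section Nemytskii

variable {f : EuclideanSpace ℝ (Fin d) → R2 → Set R2} {lf : ℝ}

theorem Admissible.ae_mem (hΩ : IsOpen Ω) (hf : Admissible Ω f lf) : ∀ᵐ x ∂leb Ω, ∀ s,
    (f x s).Nonempty ∧ IsCompact (f x s) ∧ Convex ℝ (f x s) := by
  filter_upwards [ae_restrict_mem hΩ.measurableSet] with x hx s
  exact ⟨hf.nonempty x hx s, hf.compact x hx s, hf.convex x hx s⟩

theorem Admissible.exists_envelope (hf : Admissible Ω f lf) (u : H Ω) :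
    ∃ R : EuclideanSpace ℝ (Fin d) → ℝ, MemLp R 2 (leb Ω) ∧
      ∀ᵐ x ∂leb Ω, ∀ y ∈ f x (u.at x), ‖y‖ ≤ R x := by
  obtain ⟨α, β, hα, -, h⟩ := hf.bounded
  refine ⟨fun x => α x + β * ‖u.at x‖, hα.add ((memLp_at u).norm.const_mul β), ?_⟩
  filter_upwards [h] with x hx using hx _

theorem Admissible.aemeasurable_nearest (hΩ : IsOpen Ω) (hf : Admissible Ω f lf) (u : H Ω)
    {z : EuclideanSpace ℝ (Fin d) → R2} (hz : AEMeasurable z (leb Ω)) :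
    AEMeasurable (fun x => nearest (f x (u.at x)) (z x)) (leb Ω) := by
  have h := hf.ae_mem hΩ
  refine EllipticInclusion.aemeasurable_nearest (h.mono fun x hx s => (hx s).1)
    (h.mono fun x hx s => (hx s).2.1) (h.mono fun x hx s => (hx s).2.2) (fun s O hO => ?_)
    hf.continuous (memLp_at u).aestronglyMeasurable.aemeasurable hz
  refine ((hf.measurable s O hO).mono Measure.restrict_le_self).congr ?_
  filter_upwards [ae_restrict_mem hΩ.measurableSet] with x hx
  exact propext ⟨fun h => h.2, fun h => ⟨hx, h⟩⟩

theorem Admissible.exists_mem_Nf (hΩ : IsOpen Ω) (hf : Admissible Ω f lf) (u : H Ω)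
    {z : EuclideanSpace ℝ (Fin d) → R2} (hz : AEMeasurable z (leb Ω)) :
    ∃ g ∈ Nf f u, ∀ᵐ x ∂leb Ω, g.at x = nearest (f x (u.at x)) (z x) := by
  obtain ⟨R, hR, hfR⟩ := hf.exists_envelope u
  have hm : ∀ᵐ x ∂leb Ω, nearest (f x (u.at x)) (z x) ∈ f x (u.at x) := by
    filter_upwards [hf.ae_mem hΩ] with x hx
    obtain ⟨h1, h2, h3⟩ := hx (u.at x)
    exact (nearest_spec h1 h2.isComplete h3 _).1
  have hL : MemLp (fun x => nearest (f x (u.at x)) (z x)) 2 (leb Ω) := by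
    refine hR.mono' (hf.aemeasurable_nearest hΩ u hz).aestronglyMeasurable ?_
    filter_upwards [hm, hfR] with x h1 h2 using h2 _ h1
  refine ⟨ofFun _ hL, ?_, ofFun_at _ hL⟩
  change ∀ᵐ x ∂leb Ω, _
  filter_upwards [hm, ofFun_at _ hL] with x h1 h2
  rwa [h2]

theorem Admissible.nonempty_Nf (hΩ : IsOpen Ω) (hf : Admissible Ω f lf) (u : H Ω) :
    (Nf f u).Nonempty := by
  obtain ⟨g, hg, -⟩ := hf.exists_mem_Nf hΩ u (z := 0) aemeasurable_const
  exact ⟨g, hg⟩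

theorem Admissible.convex_Nf (hΩ : IsOpen Ω) (hf : Admissible Ω f lf) (u : H Ω) :
    Convex ℝ (Nf f u) := by
  intro g hg h hh a b ha hb hab
  change ∀ᵐ x ∂leb Ω, _
  filter_upwards [hg, hh, at_add (a • g) (b • h), at_smul a g, at_smul b h, hf.ae_mem hΩ]
    with x h1 h2 h3 h4 h5 h6
  rw [h3, h4, h5]
  exact (h6 _).2.2 h1 h2 ha hb hab

/-- Convergence in `L²` gives a.e. convergence along a subsequence, extracted for one component
after the other, and the values of `f` are closed. -/
theorem Admissible.isClosed_Nf (hΩ : IsOpen Ω) (hf : Admissible Ω f lf) (u : H Ω) :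
    IsClosed (Nf f u) := by
  refine IsSeqClosed.isClosed fun g h hg hlim => ?_
  have hi : ∀ i, Tendsto (fun n => g n i) atTop (𝓝 (h i)) := fun i =>
    ((PiLp.continuous_apply 2 _ i).tendsto h).comp hlim
  obtain ⟨φ, hφ, h0⟩ := (tendstoInMeasure_of_tendsto_Lp (hi 0)).exists_seq_tendsto_ae
  obtain ⟨ψ, hψ, h1⟩ :=
    (tendstoInMeasure_of_tendsto_Lp ((hi 1).comp hφ.tendsto_atTop)).exists_seq_tendsto_ae
  change ∀ᵐ x ∂leb Ω, _
  filter_upwards [h0, h1, ae_all_iff.2 hg, hf.ae_mem hΩ] with x hx0 hx1 hxg hx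
  refine (hx (u.at x)).2.1.isClosed.mem_of_tendsto (b := atTop)
    (f := fun n => (g (φ (ψ n))).at x) ?_ (Eventually.of_forall fun n => hxg _)
  have hpi : Tendsto (fun n => ![g (φ (ψ n)) 0 x, g (φ (ψ n)) 1 x]) atTop
      (𝓝 ![h 0 x, h 1 x]) := by
    rw [tendsto_pi_nhds]
    intro i
    fin_cases i
    · exact hx0.comp hψ.tendsto_atTop
    · exact hx1
  exact ((PiLp.continuous_toLp 2 fun _ : Fin 2 => ℝ).tendsto _).comp hpi

theorem Admissible.isBounded_Nf (hf : Admissible Ω f lf) (u : H Ω) :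
    Bornology.IsBounded (Nf f u) := by
  obtain ⟨R, hR, hfR⟩ := hf.exists_envelope u
  refine isBounded_iff_forall_norm_le.2 ⟨√(∫ x in Ω, R x ^ 2), fun g hg => ?_⟩
  refine Real.le_sqrt_of_sq_le ?_
  rw [← real_inner_self_eq_norm_sq, inner_H_eq_integral]
  refine integral_mono_ae (integrable_inner_of_memLp (memLp_at g) (memLp_at g)) hR.integrable_sq ?_
  filter_upwards [hg, hfR] with x h1 h2
  rw [real_inner_self_eq_norm_sq]
  have := h2 _ h1
  gcongr

/-- Measurability comes from the approximation by nearest-point selections, integrability from the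
bound `R x * ‖w x‖` with both factors in `L²`. -/
theorem Admissible.integrable_supp (hΩ : IsOpen Ω) (hf : Admissible Ω f lf) (u : H Ω)
    {w : EuclideanSpace ℝ (Fin d) → R2} (hw : MemLp w 2 (leb Ω)) :
    Integrable (fun x => supp (w x) (f x (u.at x))) (leb Ω) := by
  obtain ⟨R, hR, hfR⟩ := hf.exists_envelope u
  have hwm := hw.aestronglyMeasurable.aemeasurable
  have hm : AEStronglyMeasurable (fun x => supp (w x) (f x (u.at x))) (leb Ω) := by
    have hn : ∀ k : ℕ, AEStronglyMeasurable
        (fun x => ⟪nearest (f x (u.at x)) (((k : ℝ) + 1) • w x), w x⟫) (leb Ω) := fun k => by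
      have hz : AEMeasurable (fun x => ((k : ℝ) + 1) • w x) (leb Ω) :=
        (measurable_const_smul _).comp_aemeasurable hwm
      exact (hf.aemeasurable_nearest hΩ u hz).aestronglyMeasurable.inner hw.aestronglyMeasurable
    refine aestronglyMeasurable_of_tendsto_ae atTop hn ?_
    filter_upwards [hfR, hf.ae_mem hΩ] with x hx hx'
    obtain ⟨h1, h2, h3⟩ := hx' (u.at x)
    exact tendsto_inner_nearest h1 h2 h3 hx (w x)
  refine (MemLp.integrable_mul (p := 2) (q := 2) hR hw.norm).mono' hm ?_
  filter_upwards [hfR, hf.ae_mem hΩ] with x hx hx'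
  exact abs_supp_le (hx' _).1 hx (w x)

theorem Admissible.inner_le_integral_supp (hΩ : IsOpen Ω) (hf : Admissible Ω f lf) (u : H Ω)
    {w : EuclideanSpace ℝ (Fin d) → R2} (hw : MemLp w 2 (leb Ω)) {g : H Ω} (hg : g ∈ Nf f u) :
    ∫ x in Ω, ⟪g.at x, w x⟫ ≤ ∫ x in Ω, supp (w x) (f x (u.at x)) := by
  obtain ⟨R, hR, hfR⟩ := hf.exists_envelope u
  refine integral_mono_ae (integrable_inner_of_memLp (memLp_at g) hw)
    (hf.integrable_supp hΩ u hw) ?_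
  filter_upwards [hg, hfR] with x h1 h2 using inner_le_supp h2 _ h1

/-- The integral of the support function is the supremum of the pairing over all selections. -/
theorem Admissible.integral_supp_le (hΩ : IsOpen Ω) (hf : Admissible Ω f lf) (u : H Ω)
    {w : EuclideanSpace ℝ (Fin d) → R2} (hw : MemLp w 2 (leb Ω)) {b : ℝ}
    (hb : ∀ g ∈ Nf f u, ∫ x in Ω, ⟪g.at x, w x⟫ ≤ b) :
    ∫ x in Ω, supp (w x) (f x (u.at x)) ≤ b := by
  obtain ⟨R, hR, hfR⟩ := hf.exists_envelope u
  have hlim : Tendsto (fun k : ℕ => b + 1 / ((k : ℝ) + 1) * ∫ x in Ω, R x ^ 2) atTop (𝓝 b) := by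
    simpa using (tendsto_one_div_add_atTop_nhds_zero_nat.mul_const
      (∫ x in Ω, R x ^ 2)).const_add b
  refine ge_of_tendsto hlim (Eventually.of_forall fun k => ?_)
  -- This selection is optimal up to the integrable error `R x ^ 2 / (k + 1)`.
  obtain ⟨g, hg, hgn⟩ := hf.exists_mem_Nf hΩ u
    (hw.aestronglyMeasurable.aemeasurable.const_smul ((k : ℝ) + 1))
  have hi := integrable_inner_of_memLp (memLp_at g) hw
  have hRi := hR.integrable_sq.const_mul (1 / ((k : ℝ) + 1))
  refine le_trans ?_ (add_le_add_left (hb g hg) _)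
  rw [← integral_const_mul, ← integral_add hi hRi]
  refine integral_mono_ae (hf.integrable_supp hΩ u hw) (hi.add hRi) ?_
  filter_upwards [hfR, hf.ae_mem hΩ, hgn] with x hx hx' hxg
  obtain ⟨h1, h2, h3⟩ := hx' (u.at x)
  simp only [hxg]
  exact supp_le_inner_nearest_add h1 h2 h3 hx (w x) (by positivity)

end Nemytskii

/-! ### Projections with respect to `‖·‖_W` -/

theorem mem_projW_zero {lf : ℝ} {M : Set (V Ω)} {p : V Ω} :
    p ∈ projW lf 0 M ↔ p ∈ M ∧ ∀ m ∈ M, normW lf p ≤ normW lf m := by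
  have hneg : ∀ w : V Ω, normW lf (0 - w) = normW lf w := fun w => by
    rw [normW, normW, ← innerWL_apply, ← innerWL_apply]
    simp
  have hbd : BddBelow ((fun x' : V Ω => normW lf (0 - x')) '' M) := ⟨0, by
    rintro _ ⟨m, -, rfl⟩
    exact Real.sqrt_nonneg _⟩
  refine and_congr_right fun hp => ?_
  rw [hneg, distW]
  constructor
  · intro h m hm
    rw [h, ← hneg m]
    exact csInf_le hbd ⟨m, hm, rfl⟩
  · intro h
    refine le_antisymm (le_csInf ⟨_, p, hp, rfl⟩ ?_) ?_
    · rintro _ ⟨m, hm, rfl⟩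
      simp only [hneg]
      exact h m hm
    · rw [← hneg p]
      exact csInf_le hbd ⟨p, hp, rfl⟩

theorem innerW_sub_nonneg {lf : ℝ} (hlf : lf < 1 / embConst Ω ^ 2) {M : Set (V Ω)}
    (hM : Convex ℝ M) {p m : V Ω} (hp : p ∈ projW lf 0 M) (hm : m ∈ M) :
    0 ≤ innerW lf p (m - p) := by
  obtain ⟨hpM, hmin⟩ := mem_projW_zero.1 hp
  set c := innerW lf p (m - p) with hc
  set A := innerW lf (m - p) (m - p) with hA
  have hA0 : 0 ≤ A := innerW_self_nonneg hlf _
  by_contra hneg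
  push Not at hneg
  -- With this step `t * A ≤ -c`, so the increment `t * (2 * c + t * A)` of the squared norm would
  -- be negative; the `+ 1` keeps the denominator positive.
  set t := min 1 (-c / (A + 1)) with ht
  have ht0 : 0 < t := lt_min one_pos (div_pos (neg_pos.2 hneg) (by linarith))
  have h1 := hmin _ (hM.add_smul_sub_mem hpM hm ⟨ht0.le, min_le_left _ _⟩)
  have h2 : innerW lf p p ≤ innerW lf (p + t • (m - p)) (p + t • (m - p)) := by
    rw [← normW_sq hlf, ← normW_sq hlf]
    exact pow_le_pow_left₀ (Real.sqrt_nonneg _) h1 2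
  rw [innerW_add_left, innerW_add_right, innerW_add_right, innerW_smul_right,
    innerW_comm lf (t • (m - p)) p, innerW_comm lf (t • (m - p)) (t • (m - p)),
    innerW_smul_right, innerW_comm lf (t • (m - p)) (t • (m - p)), innerW_smul_right,
    innerW_comm lf (t • (m - p)) (m - p), innerW_smul_right, ← hc, ← hA] at h2
  have h3 : t * (A + 1) ≤ -c := (le_div_iff₀ (by linarith)).1 (min_le_right _ _)
  have h4 : 0 ≤ t * (2 * c + t * A) := by linarith
  have h5 : 0 ≤ 2 * c + t * A := nonneg_of_mul_nonneg_right h4 ht0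
  linarith

/-! ### The residual set and its unique projection -/

section Iteration

variable {f : EuclideanSpace ℝ (Fin d) → R2 → Set R2} {lf : ℝ}

theorem residualSet_eq_image (hlf : lf < 1 / embConst Ω ^ 2) (v : V Ω) :
    residualSet f lf v =
      (fun g => rieszW hlf (FV v) + (rieszW hlf).comp toDualL g) '' Nf f (toH v) := by
  ext w
  simp only [residualSet, Set.mem_ofPred_eq, Set.mem_image, ContinuousLinearMap.comp_apply,
    toDualL_apply, JW_eq_rieszW hlf, eq_comm (a := w)]

theorem Admissible.convex_residualSet (hΩ : IsOpen Ω) (hf : Admissible Ω f lf)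
    (hlf : lf < 1 / embConst Ω ^ 2) (v : V Ω) : Convex ℝ (residualSet f lf v) := by
  rw [residualSet_eq_image hlf, ← Set.image_image (fun w => rieszW hlf (FV v) + w)]
  exact ((hf.convex_Nf hΩ (toH v)).linear_image
    ((rieszW hlf).comp toDualL).toLinearMap).translate _

theorem Admissible.exists_projW_eq_singleton (hΩ : IsOpen Ω) (hf : Admissible Ω f lf)
    (hlf : lf < 1 / embConst Ω ^ 2) (v : V Ω) :
    ∃ p : V Ω, projW lf 0 (residualSet f lf v) = {p} := by
  set w₀ := rieszW hlf (FV v)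
  set T : H Ω →L[ℝ] V Ω := (rieszW hlf).comp toDualL
  have hφ : Continuous fun g => innerW lf (w₀ + T g) (w₀ + T g) := by
    simp only [← innerWL_apply]
    fun_prop
  -- Minimizing over the selections, a closed bounded set in `H`, avoids having to show that the
  -- residual set is closed in `V`.
  obtain ⟨g, hg, hmin⟩ := exists_forall_le_of_convexOn (hf.nonempty_Nf hΩ (toH v))
    (hf.isClosed_Nf hΩ (toH v)) (hf.isBounded_Nf (toH v)) hφ
    (convexOn_innerW_self hlf w₀ T (hf.convex_Nf hΩ (toH v)))
    fun g => innerW_self_nonneg hlf _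
  have hp : w₀ + T g ∈ projW lf 0 (residualSet f lf v) := by
    rw [mem_projW_zero, residualSet_eq_image hlf]
    refine ⟨⟨g, hg, rfl⟩, ?_⟩
    rintro _ ⟨g', hg', rfl⟩
    exact Real.sqrt_le_sqrt (hmin g' hg')
  refine ⟨w₀ + T g, Set.eq_singleton_iff_unique_mem.2 ⟨hp, fun q hq => ?_⟩⟩
  have hc := hf.convex_residualSet hΩ hlf v
  -- The sum of the two variational inequalities says `‖q - p‖_W² ≤ 0`.
  have h1 := innerW_sub_nonneg hlf hc hp hq.1
  have h2 := innerW_sub_nonneg hlf hc hq hp.1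
  refine sub_eq_zero.1 (eq_zero_of_innerW_self_le hlf ?_)
  simp only [innerW_sub_left, innerW_sub_right] at h1 h2 ⊢
  linarith

/-! ### The functional -/

theorem memLp_neg_at (h : V Ω) : MemLp (fun x => -(toH h).at x) 2 (leb Ω) :=
  (memLp_at (toH h)).neg

theorem Admissible.integrable_suppIntegrand (hΩ : IsOpen Ω) (hf : Admissible Ω f lf) (u h : V Ω) :
    Integrable (suppIntegrand f u h) (leb Ω) :=
  hf.integrable_supp hΩ (toH u) (memLp_neg_at h)

theorem integral_inner_neg_at (g : H Ω) (h : V Ω) :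
    ∫ x in Ω, ⟪g.at x, -(toH h).at x⟫ = -⟪g, toH h⟫ := by
  simp_rw [inner_neg_right, integral_neg, inner_H_eq_integral]

/-- The selection `g₀` behind `p` is optimal for `-p` and a competitor for `-h`. Since `FV u + g₀`
is represented by `p`, what remains is `½ ‖h‖_W² - (p, h)_W`, whose square is completed at `p`. -/
theorem Admissible.functional_add_le (hΩ : IsOpen Ω) (hf : Admissible Ω f lf)
    (hlf : lf < 1 / embConst Ω ^ 2) {u p : V Ω} (hp : p ∈ projW lf 0 (residualSet f lf u))
    (h : V Ω) :
    functional f lf u p + 1 / 2 * innerW lf (h - p) (h - p) ≤ functional f lf u h := by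
  obtain ⟨g₀, hg₀, hpg⟩ := hp.1
  have hres : ∀ (g : H Ω) (w : V Ω),
      innerW lf (JW lf (FV u) + JW lf (toDual g)) w = FV u w + ⟪g, toH w⟫ := fun g w => by
    rw [innerW_add_left, innerW_JW hlf, innerW_JW hlf, toDual_apply]
  have hpp : innerW lf p p = FV u p + ⟪g₀, toH p⟫ := by
    nth_rewrite 1 [hpg]
    exact hres g₀ p
  have h1 : -⟪g₀, toH h⟫ ≤ ∫ x in Ω, suppIntegrand f u h x := by
    rw [← integral_inner_neg_at]
    exact hf.inner_le_integral_supp hΩ (toH u) (memLp_neg_at h) hg₀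
  have h2 : ∫ x in Ω, suppIntegrand f u p x ≤ -⟪g₀, toH p⟫ := by
    refine hf.integral_supp_le hΩ (toH u) (memLp_neg_at p) fun g hg => ?_
    rw [integral_inner_neg_at]
    have h3 := innerW_sub_nonneg hlf (hf.convex_residualSet hΩ hlf u) hp ⟨g, hg, rfl⟩
    rw [innerW_sub_right, innerW_comm, hres, hpp] at h3
    linarith
  have hph : innerW lf p h = FV u h + ⟪g₀, toH h⟫ := by rw [hpg, hres]
  rw [functional, functional, normW_sq hlf, normW_sq hlf, innerW_sub_left, innerW_sub_right,
    innerW_sub_right, innerW_comm lf h p]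
  linarith

theorem Admissible.integral_fullIntegrand (hΩ : IsOpen Ω) (hf : Admissible Ω f lf)
    (hlf : lf < 1 / embConst Ω ^ 2) (u h : V Ω) :
    Integrable (fullIntegrand f lf u h) (leb Ω) ∧
      functional f lf u h = ∫ x in Ω, fullIntegrand f lf u h x := by
  have hs := hf.integrable_suppIntegrand hΩ u h
  have hg : ∀ i, Integrable (fun x => ‖grad Ω (h i) x‖ ^ 2) (leb Ω) := fun i => by
    simpa only [real_inner_self_eq_norm_sq] using
      L2.integrable_inner (𝕜 := ℝ) (grad Ω (h i)) (grad Ω (h i))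
  have hv : ∀ i, Integrable (fun x => |val Ω (h i) x| ^ 2) (leb Ω) := fun i => by
    simpa only [real_inner_self_eq_norm_sq, Real.norm_eq_abs] using
      L2.integrable_inner (𝕜 := ℝ) (val Ω (h i)) (val Ω (h i))
  have hi : ∀ i, Integrable (fun x => ⟪grad Ω (h i) x, grad Ω (u i) x⟫) (leb Ω) := fun i =>
    L2.integrable_inner (𝕜 := ℝ) (grad Ω (h i)) (grad Ω (u i))
  have hsub : ∀ i, Integrable (fun x => ‖grad Ω (h i) x‖ ^ 2 - lf * |val Ω (h i) x| ^ 2)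
      (leb Ω) := fun i => (hg i).sub ((hv i).const_mul lf)
  have hterm : ∀ i, Integrable (fun x => ‖grad Ω (h i) x‖ ^ 2 - lf * |val Ω (h i) x| ^ 2
      + 2 * ⟪grad Ω (h i) x, grad Ω (u i) x⟫) (leb Ω) :=
    fun i => (hsub i).add ((hi i).const_mul 2)
  have hsum := (integrable_finsetSum Finset.univ fun i _ => hterm i).const_mul (1 / 2)
  have eg : ∀ i, ∫ x in Ω, ‖grad Ω (h i) x‖ ^ 2 = ⟪grad Ω (h i), grad Ω (h i)⟫ := fun i => by
    simp only [L2.inner_def, real_inner_self_eq_norm_sq]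
  have ev : ∀ i, ∫ x in Ω, |val Ω (h i) x| ^ 2 = ⟪val Ω (h i), val Ω (h i)⟫ := fun i => by
    rw [L2.inner_def]
    simp only [real_inner_self_eq_norm_sq, Real.norm_eq_abs]
  have ei : ∀ i, ∫ x in Ω, ⟪grad Ω (h i) x, grad Ω (u i) x⟫ = ⟪grad Ω (h i), grad Ω (u i)⟫ :=
    fun i => (L2.inner_def _ _).symm
  have et : ∀ i, ∫ x in Ω, (‖grad Ω (h i) x‖ ^ 2 - lf * |val Ω (h i) x| ^ 2
      + 2 * ⟪grad Ω (h i) x, grad Ω (u i) x⟫) = ⟪grad Ω (h i), grad Ω (h i)⟫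
      - lf * ⟪val Ω (h i), val Ω (h i)⟫ + 2 * ⟪grad Ω (h i), grad Ω (u i)⟫ := fun i => by
    rw [integral_add (hsub i) ((hi i).const_mul 2), integral_sub (hg i) ((hv i).const_mul lf),
      integral_const_mul, integral_const_mul, eg, ev, ei]
  refine ⟨hsum.add hs, ?_⟩
  unfold fullIntegrand
  rw [integral_add hsum hs, integral_const_mul, integral_finsetSum _ fun i _ => hterm i]
  simp only [et]
  rw [functional, normW_sq hlf, FV_apply, innerW, innerV, innerV, inner_H]
  simp only [toH_apply, Fin.sum_univ_two, real_inner_comm (grad Ω (u _))]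
  ring

end Iteration

end EllipticInclusion

end

/-! ### The minimization property of the iteration step -/

open EllipticInclusion in
theorem corollary19 {d : ℕ} (hd : 0 < d) (Ω : Set (EuclideanSpace ℝ (Fin d)))
    (hΩo : IsOpen Ω) (hΩc : IsConnected Ω) (hΩb : Bornology.IsBounded Ω)
    (f : EuclideanSpace ℝ (Fin d) → R2 → Set R2) (lf : ℝ) (hf : Admissible Ω f lf)
    (hlf : lf < 1 / embConst Ω ^ 2) (l : ℝ) (hl : l < 0) :
    -- the iteration is well defined: the projection is a single point
    (∀ v : V Ω, ∃ p : V Ω, projW lf 0 (residualSet f lf v) = {p}) ∧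
    ∀ u : ℕ → V Ω, IsIteration f lf l u → ∀ n : ℕ,
      -- the integrals in the functional exist, and its two expressions agree
      (∀ h : V Ω, Integrable (suppIntegrand f (u n) h) (volume.restrict Ω) ∧
        Integrable (fullIntegrand f lf (u n) h) (volume.restrict Ω) ∧
        functional f lf (u n) h = ∫ x in Ω, fullIntegrand f lf (u n) h x) ∧
      -- `-2l(u_{n+1} - u_n)` is the unique minimizer
      (∀ h : V Ω, functional f lf (u n) (-(2 * l) • (u (n + 1) - u n)) ≤ functional f lf (u n) h) ∧
      ∀ h : V Ω, (∀ h' : V Ω, functional f lf (u n) h ≤ functional f lf (u n) h') →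
        h = -(2 * l) • (u (n + 1) - u n) := by

  refine ⟨hf.exists_projW_eq_singleton hΩo hlf, fun u hu n => ?_⟩
  obtain ⟨p, hp, hun⟩ := hu n
  have hpu : -(2 * l) • (u (n + 1) - u n) = p := by
    have hl2 : 2 * l * (1 / (2 * l)) = 1 := mul_one_div_cancel (by linarith)
    rw [hun, sub_sub_cancel_left, smul_neg, neg_smul, neg_neg, smul_smul, hl2, one_smul]
  rw [hpu]
  have key := hf.functional_add_le hΩo hlf hp
  refine ⟨fun h => ⟨hf.integrable_suppIntegrand hΩo (u n) h,
    hf.integral_fullIntegrand hΩo hlf (u n) h⟩, fun h => ?_, fun h hmin => ?_⟩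
  · linarith [key h, innerW_self_nonneg hlf (h - p)]
  · exact sub_eq_zero.1 (eq_zero_of_innerW_self_le hlf (by linarith [key h, hmin p]))
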